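/- Let $n\ge 8$, $T\ge 1$, $L>0$. Let $\ell_1,\dots,\ell_T:\mathbb R^n\to\mathbb R$ be a fixed sequence of differentiable convex functions that are $L$-smooth in the sense that $$\ell_t(x)-\ell_t(y)-\langle\nabla\ell_t(y),x-y\rangle\ \ge\ \tfrac1{2L}\|\nabla\ell_t(x)-\nabla\ell_t(y)\|^2\qquad\text{for all }x,y\in\mathbb R^n,$$ and let $\mathcal X\subset\mathbb R^n$ be a closed, bounded, convex set with $\operatorname{diam}(\mathcal X)\le D$. Here $\|\cdot\|$ and $\langle\cdot,\cdot\rangle$ are Euclidean. Fix a step $\eta>0$, a smoothing parameter $\mu>0$ and an initial point $x^1\in\mathcal X$, let $s_1,\dots,s_T$ be independent and uniformly distributed on the unit sphere of $\mathbb R^n$, and define bandit gradient descent by $$g_t=\tfrac{n}{2\mu}\bigl[\ell_t(x^t+\mu s_t)-\ell_t(x^t-\mu s_t)\bigr]s_t,\qquad x^{t+1}=\Pi_{\mathcal X}[x^t-\eta g_t],$$ where $\Pi_{\mathcal X}$ is the orthogonal projection onto $\mathcal X$. Put $\rho_T(x)=\sum_{t=1}^T\ell_t(x^t)-\sum_{t=1}^T\ell_t(x)$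 and $G_T(x)=\sum_{t=1}^T\|\nabla\ell_t(x)\|^2$. (i) If $\eta\in(0,\tfrac1{4nL})$ and $\mu>0$, then for every $x\in\mathcal X$ the random variable $\rho_T(x)$ is integrable and $$\mathbb E[\rho_T(x)]\le \frac{D^2}{2\eta}+\frac{4n\eta}{1-4n\eta L}G_T(x)+\frac{4n\eta}{1-4n\eta L}TL^2\mu^2+\frac{\eta T}{2}n^2L^2\mu^2+\frac{TL\mu^2}{2}.$$ (ii) Let $x^\star\in\operatorname{argmin}_{x\in\mathcal X}\sum_{t=1}^T\ell_t(x)$ and $G_T^\star=G_T(x^\star)$. If $\eta=\min\bigl\{\tfrac{D}{4\sqrt{nG_T^\star}},\tfrac1{8nL}\bigr\}$ (read as $\tfrac1{8nL}$ if $G_T^\star=0$) and $0<\mu\le\tfrac{D}{\sqrt{2nT}}$, in particular if $\mu=\tfrac{D}{\sqrt{2nT}}$ and $D>0$, then $\rho_T(x^\star)$ is integrable and $$\mathbb E[\rho_T(x^\star)]\le\max\bigl\{8nLD^2,\,4D\sqrt{nG_T^\star}\bigr\}+\frac{LD^2}{2}.$$ -/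

import Mathlib

open MeasureTheory ProbabilityTheory
open scoped BigOperators

namespace BanditGD

/-- `ℓ` is convex and `L`-smooth on `ℝⁿ`: it is differentiable, convex, and satisfies
`ℓ x - ℓ y - ⟪∇ℓ y, x - y⟫ ≥ (1 / (2 L)) ‖∇ℓ x - ∇ℓ y‖²` for all `x`, `y`. -/
structure IsSmoothConvex {n : ℕ} (L : ℝ) (f : EuclideanSpace ℝ (Fin n) → ℝ) : Prop where
  differentiable : Differentiable ℝ f
  convexOn : ConvexOn ℝ Set.univ f
  lower_bound : ∀ x y : EuclideanSpace ℝ (Fin n),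
    1 / (2 * L) * ‖gradient f x - gradient f y‖ ^ 2 ≤
      f x - f y - inner ℝ (gradient f y) (x - y)

/-- The orthogonal projection onto a set `K`: a point of `K` that is nearest to `y`.
It exists and is unique when `K` is nonempty, closed and convex. -/
noncomputable def proj {n : ℕ} (K : Set (EuclideanSpace ℝ (Fin n)))
    (y : EuclideanSpace ℝ (Fin n)) : EuclideanSpace ℝ (Fin n) :=
  Classical.epsilon fun z => z ∈ K ∧ ∀ w ∈ K, dist y z ≤ dist y w

theorem proj_spec {n : ℕ} {K : Set (EuclideanSpace ℝ (Fin n))} (hne : K.Nonempty)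
    (hcl : IsClosed K) (y : EuclideanSpace ℝ (Fin n)) :
    proj K y ∈ K ∧ ∀ w ∈ K, dist y (proj K y) ≤ dist y w := by
  have h : ∃ z, z ∈ K ∧ ∀ w ∈ K, dist y z ≤ dist y w := by
    obtain ⟨z, hz, hzd⟩ := hcl.exists_infDist_eq_dist hne y
    exact ⟨z, hz, fun w hw => hzd ▸ Metric.infDist_le_dist_of_mem hw⟩
  exact Classical.epsilon_spec h

/-- The uniform probability distribution on the unit sphere of `ℝⁿ`, as a measure on `ℝⁿ`:
the normalized surface measure. -/
noncomputable def uniformSphere (n : ℕ) : Measure (EuclideanSpace ℝ (Fin n)) :=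
  ((volume : Measure (EuclideanSpace ℝ (Fin n))).toSphere Set.univ)⁻¹ •
    (volume : Measure (EuclideanSpace ℝ (Fin n))).toSphere.map Subtype.val

/-- The two-point gradient estimator
`(n / (2 μ)) [f (x + μ s) - f (x - μ s)] s` with direction `s`. -/
noncomputable def gradEstimator {n : ℕ} (f : EuclideanSpace ℝ (Fin n) → ℝ) (μ : ℝ)
    (x s : EuclideanSpace ℝ (Fin n)) : EuclideanSpace ℝ (Fin n) :=
  ((n : ℝ) / (2 * μ) * (f (x + μ • s) - f (x - μ • s))) • s

/-- The decisions of bandit gradient descent with constant step `η`, smoothing parameter `μ`,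
initial decision `x₁` and directions `s`. Rounds are counted from `0`: round `t` has the loss
`ℓ t`, the direction `s t` and the decision `bgd K ℓ η μ x₁ s t`. -/
noncomputable def bgd {n : ℕ} (K : Set (EuclideanSpace ℝ (Fin n)))
    (ℓ : ℕ → EuclideanSpace ℝ (Fin n) → ℝ) (η μ : ℝ) (x₁ : EuclideanSpace ℝ (Fin n))
    (s : ℕ → EuclideanSpace ℝ (Fin n)) : ℕ → EuclideanSpace ℝ (Fin n)
  | 0 => x₁
  | t + 1 => proj K (bgd K ℓ η μ x₁ s t -
      η • gradEstimator (ℓ t) μ (bgd K ℓ η μ x₁ s t) (s t))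

/-- The regret of the decisions `p` over `T` rounds against the fixed decision `x`. -/
noncomputable def regret {n : ℕ} (ℓ : ℕ → EuclideanSpace ℝ (Fin n) → ℝ) (T : ℕ)
    (p : ℕ → EuclideanSpace ℝ (Fin n)) (x : EuclideanSpace ℝ (Fin n)) : ℝ :=
  ∑ t ∈ Finset.range T, ℓ t (p t) - ∑ t ∈ Finset.range T, ℓ t x

/-- The cumulative non-stationarity `G_T(x) = ∑ ‖∇ℓ_t(x)‖²`. -/
noncomputable def cumGrad {n : ℕ} (ℓ : ℕ → EuclideanSpace ℝ (Fin n) → ℝ) (T : ℕ)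
    (x : EuclideanSpace ℝ (Fin n)) : ℝ :=
  ∑ t ∈ Finset.range T, ‖gradient (ℓ t) x‖ ^ 2

/-- The step `min {D / (4 √(n G)), 1 / (8 n L)}`, where the first term is `+∞` if `G = 0`. -/
noncomputable def tunedStep (n : ℕ) (L D G : ℝ) : ℝ :=
  if G = 0 then 1 / (8 * n * L) else min (D / (4 * √(n * G))) (1 / (8 * n * L))

end BanditGD

/-! Nonexpansiveness of the projection and telescoping bound the regret against `u` by `D ^ 2 / (2 *
η)` plus, per round, `f x - f u - ⟪g, x - u⟫ + η / 2 * ‖g‖ ^ 2`. The decision depends only on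
earlier directions, so it is enough to average this term over the sphere with `x` fixed
(`integral_step_le`). Isotropy gives `‖g‖ ^ 2` a mean of at most `2 * n * ‖∇f x‖ ^ 2` plus `O(μ ^
2)`. The mean of `⟪g, x - u⟫` exceeds `f x - f u` by `a * ‖∇f x‖ ^ 2`, up to `4 * a * ‖∇f u‖ ^ 2`
and `O(μ ^ 2)`, because smooth convexity controls gradient differences. With `a = n * η` the two
`‖∇f x‖ ^ 2` terms cancel and only the gradients at `u` survive. The mean of `g` is the mean of `∇f`
over the ball of radius `μ`. This divergence identity enters as a differential equation in the
radius, and the integration by parts behind it follows from rotation invariance alone. -/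

namespace BanditGD

/-! ### Rotation invariance and integration by parts on the sphere. -/

section Sphere

open Set Metric Filter Topology
open scoped Pointwise

variable {n : ℕ}

theorem isProbabilityMeasure_uniformSphere (hn : n ≠ 0) :
    IsProbabilityMeasure (uniformSphere n) := by
  have : NeZero n := ⟨hn⟩
  refine ⟨?_⟩
  rw [uniformSphere, Measure.smul_apply, Measure.map_apply measurable_subtype_coe .univ,
    preimage_univ, smul_eq_mul]
  refine ENNReal.inv_mul_cancel ?_ (measure_ne_top _ _)
  rw [Ne, Measure.measure_univ_eq_zero]
  exact Measure.toSphere_ne_zero _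

theorem ae_norm_eq_one_uniformSphere : ∀ᵐ s ∂(uniformSphere n), ‖s‖ = 1 := by
  refine Measure.ae_smul_measure ?_ _
  rw [ae_map_iff measurable_subtype_coe.aemeasurable
    (measurableSet_eq_fun measurable_norm measurable_const)]
  exact Eventually.of_forall fun s => norm_eq_of_mem_sphere s

/-- Surface measure of a set is, up to a constant, the volume of the cone over it; linear isometries
preserve volume and commute with forming cones. -/
theorem map_uniformSphere (R : EuclideanSpace ℝ (Fin n) ≃ₗᵢ[ℝ] EuclideanSpace ℝ (Fin n)) :
    (uniformSphere n).map R = uniformSphere n := by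
  rw [uniformSphere, Measure.map_smul]
  congr 1
  ext B hB
  have hR : Measurable R := R.continuous.measurable
  rw [Measure.map_apply hR hB, Measure.map_apply measurable_subtype_coe (hR hB),
    Measure.map_apply measurable_subtype_coe hB,
    Measure.toSphere_apply' _ (measurable_subtype_coe (hR hB)),
    Measure.toSphere_apply' _ (measurable_subtype_coe hB)]
  congr 1
  conv_rhs => rw [← (R.measurePreserving).measure_preimage_equiv (f := R.toMeasurableEquiv)]
  congr 1
  ext y
  rw [mem_preimage, Set.mem_smul, Set.mem_smul]
  constructor
  · rintro ⟨r, hr, _, ⟨z, hz, rfl⟩, rfl⟩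
    exact ⟨r, hr, R z, ⟨⟨R z, by simp⟩, hz, rfl⟩, (map_smul R r _).symm⟩
  · rintro ⟨r, hr, _, ⟨z, hz, rfl⟩, hy⟩
    refine ⟨r, hr, R.symm z, ⟨⟨R.symm z, by simp⟩, by simpa using hz, rfl⟩, ?_⟩
    apply R.injective
    exact (map_smul R r _).trans (by simpa using hy)

theorem integral_comp_isometry_uniformSphere
    (R : EuclideanSpace ℝ (Fin n) ≃ₗᵢ[ℝ] EuclideanSpace ℝ (Fin n))
    (g : EuclideanSpace ℝ (Fin n) → ℝ) :
    ∫ s, g (R s) ∂(uniformSphere n) = ∫ s, g s ∂(uniformSphere n) := by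
  conv_rhs => rw [← map_uniformSphere R]
  exact (integral_map_equiv R.toMeasurableEquiv g).symm

theorem integrable_uniformSphere (hn : n ≠ 0) {g : EuclideanSpace ℝ (Fin n) → ℝ}
    (hg : Continuous g) : Integrable g (uniformSphere n) := by
  have := isProbabilityMeasure_uniformSphere hn
  obtain ⟨C, hC⟩ := (isCompact_sphere (0 : EuclideanSpace ℝ (Fin n)) 1).exists_bound_of_continuousOn
    hg.continuousOn
  refine Integrable.of_bound hg.aestronglyMeasurable C ?_
  filter_upwards [ae_norm_eq_one_uniformSphere] with s hs
  exact hC s (by simpa using hs)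

theorem hasDerivAt_integral_uniformSphere (hn : n ≠ 0)
    {F F' : ℝ → EuclideanSpace ℝ (Fin n) → ℝ} (hF : ∀ t, Continuous (F t))
    (hF' : Continuous (Function.uncurry F')) (h : ∀ t s, HasDerivAt (F · s) (F' t s) t) (t : ℝ) :
    HasDerivAt (fun t => ∫ s, F t s ∂(uniformSphere n)) (∫ s, F' t s ∂(uniformSphere n)) t := by
  have := isProbabilityMeasure_uniformSphere hn
  obtain ⟨C, hC⟩ := ((isCompact_Icc (a := t - 1) (b := t + 1)).prod
    (isCompact_sphere (0 : EuclideanSpace ℝ (Fin n)) 1)).exists_bound_of_continuousOn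
    hF'.continuousOn
  refine (hasDerivAt_integral_of_dominated_loc_of_deriv_le (bound := fun _ => C)
    (Icc_mem_nhds (by linarith : t - 1 < t) (by linarith : t < t + 1))
    (Eventually.of_forall fun t => (hF t).aestronglyMeasurable)
    (integrable_uniformSphere hn (hF t))
    (hF'.comp (Continuous.prodMk_right t)).aestronglyMeasurable ?_ (integrable_const C)
    (Eventually.of_forall fun s t _ => h t s)).2
  filter_upwards [ae_norm_eq_one_uniformSphere] with s hs t ht
  exact hC (t, s) ⟨ht, by simpa using hs⟩

/-- Each `exp (t • A)` is orthogonal, so the mean of `g ∘ exp (t • A)` is constant in `t`; this is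
its derivative at `t = 0`. -/
theorem integral_inner_gradient_skewAdjoint (hn : n ≠ 0)
    {g : EuclideanSpace ℝ (Fin n) → ℝ}
    {G : EuclideanSpace ℝ (Fin n) → EuclideanSpace ℝ (Fin n)}
    (hg : ∀ x, HasGradientAt g (G x) x) (hG : Continuous G)
    {A : EuclideanSpace ℝ (Fin n) →L[ℝ] EuclideanSpace ℝ (Fin n)}
    (hA : A ∈ skewAdjoint (EuclideanSpace ℝ (Fin n) →L[ℝ] EuclideanSpace ℝ (Fin n))) :
    ∫ s, inner ℝ (G s) (A s) ∂(uniformSphere n) = 0 := by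
  let V := EuclideanSpace ℝ (Fin n)
  have hgc : Continuous g := continuous_iff_continuousAt.2 fun x => (hg x).continuousAt
  have hexp : Continuous fun t : ℝ => NormedSpace.exp (t • A) :=
    continuous_iff_continuousAt.2 fun t => (hasDerivAt_exp_smul_const A t).continuousAt
  have hderiv : ∀ (t : ℝ) (s : V), HasDerivAt (fun t : ℝ => g (NormedSpace.exp (t • A) s))
      (inner ℝ (G (NormedSpace.exp (t • A) s)) (NormedSpace.exp (t • A) (A s))) t := by
    intro t s
    have h1 : HasDerivAt (fun t : ℝ => NormedSpace.exp (t • A) s)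
        (NormedSpace.exp (t • A) (A s)) t := by
      simpa using (hasDerivAt_exp_smul_const A t).clm_apply (hasDerivAt_const t s)
    exact (hg (NormedSpace.exp (t • A) s)).hasFDerivAt.comp_hasDerivAt t h1
  have hd := hasDerivAt_integral_uniformSphere hn
    (F := fun t s => g (NormedSpace.exp (t • A) s))
    (F' := fun t s => inner ℝ (G (NormedSpace.exp (t • A) s)) (NormedSpace.exp (t • A) (A s)))
    (fun t => hgc.comp (NormedSpace.exp (t • A)).continuous)
    (by
      have h1 : Continuous fun p : ℝ × V => NormedSpace.exp (p.1 • A) p.2 :=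
        (hexp.comp continuous_fst).clm_apply continuous_snd
      have h2 : Continuous fun p : ℝ × V => NormedSpace.exp (p.1 • A) (A p.2) :=
        (hexp.comp continuous_fst).clm_apply (A.continuous.comp continuous_snd)
      exact (hG.comp h1).inner h2) hderiv 0
  let _ : NormedAlgebra ℚ (V →L[ℝ] V) := NormedAlgebra.restrictScalars ℚ ℝ _
  have hconst : (fun t : ℝ => ∫ s, g (NormedSpace.exp (t • A) s) ∂(uniformSphere n)) =
      fun _ => ∫ s, g s ∂(uniformSphere n) := by
    funext t
    have hU : NormedSpace.exp (t • A) ∈ unitary (V →L[ℝ] V) :=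
      NormedSpace.exp_mem_unitary_of_mem_skewAdjoint (skewAdjoint.smul_mem t hA)
    exact integral_comp_isometry_uniformSphere (Unitary.linearIsometryEquiv ⟨_, hU⟩) g
  rw [hconst] at hd
  have h0 := hd.unique (hasDerivAt_const _ _)
  have h1 : NormedSpace.exp ((0 : ℝ) • A) = 1 := by
    rw [show (0 : ℝ) • A = 0 from zero_smul ℝ A, NormedSpace.exp_zero]
  simp only [h1] at h0
  exact h0

/-- Integration by parts on the unit sphere. -/
theorem integral_mul_inner_uniformSphere (hn : n ≠ 0)
    {g : EuclideanSpace ℝ (Fin n) → ℝ}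
    {G : EuclideanSpace ℝ (Fin n) → EuclideanSpace ℝ (Fin n)}
    (hg : ∀ x, HasGradientAt g (G x) x) (hG : Continuous G) (d : EuclideanSpace ℝ (Fin n)) :
    ((n : ℝ) - 1) * ∫ s, g s * inner ℝ s d ∂(uniformSphere n) =
      ∫ s, (inner ℝ (G s) d - inner ℝ (G s) s * inner ℝ s d) ∂(uniformSphere n) := by
  let V := EuclideanSpace ℝ (Fin n)
  let b := EuclideanSpace.basisFun (Fin n) ℝ
  have hgc : Continuous g := continuous_iff_continuousAt.2 fun x => (hg x).continuousAt
  -- Generators of the rotations in the planes spanned by `b i` and `d`. Testing them on `g s * ⟪b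
  -- i, s⟫` and summing over `i` recovers the formula, by Parseval and `‖s‖ = 1`.
  let A : Fin n → V →L[ℝ] V := fun i =>
    (innerSL ℝ (b i)).smulRight d - (innerSL ℝ d).smulRight (b i)
  have hAapp : ∀ i s, A i s = inner ℝ (b i) s • d - inner ℝ d s • b i := fun i s => rfl
  have hA : ∀ i, A i ∈ skewAdjoint (V →L[ℝ] V) := by
    intro i
    rw [skewAdjoint.mem_iff, ContinuousLinearMap.star_eq_adjoint, eq_comm,
      ContinuousLinearMap.eq_adjoint_iff]
    intro x y
    simp only [neg_apply, hAapp, inner_neg_left, inner_sub_left,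
      inner_sub_right, real_inner_smul_left, real_inner_smul_right]
    rw [real_inner_comm x (b i), real_inner_comm x d]
    ring
  have hgrad : ∀ i x, HasGradientAt (fun s => g s * inner ℝ (b i) s)
      (inner ℝ (b i) x • G x + g x • b i) x := by
    intro i x
    have h1 := (hg x).hasFDerivAt.mul ((innerSL ℝ (b i)).hasFDerivAt (x := x))
    rw [hasGradientAt_iff_hasFDerivAt]
    refine h1.congr_fderiv ?_
    ext y
    simp
    ring
  have hzero : ∀ i, ∫ s, inner ℝ (inner ℝ (b i) s • G s + g s • b i) (A i s)
      ∂(uniformSphere n) = 0 := fun i =>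
    integral_inner_gradient_skewAdjoint hn (hgrad i) (by fun_prop) (hA i)
  have hsum : ∫ s, ∑ i, inner ℝ (inner ℝ (b i) s • G s + g s • b i) (A i s)
      ∂(uniformSphere n) = 0 := by
    rw [integral_finsetSum _ fun i _ => integrable_uniformSphere hn (by fun_prop)]
    exact Finset.sum_eq_zero fun i _ => hzero i
  have hpt : ∀ᵐ s ∂(uniformSphere n),
      ∑ i, inner ℝ (inner ℝ (b i) s • G s + g s • b i) (A i s) =
        (inner ℝ (G s) d - inner ℝ (G s) s * inner ℝ s d)
          - ((n : ℝ) - 1) * (g s * inner ℝ s d) := by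
    filter_upwards [ae_norm_eq_one_uniformSphere] with s hs
    have e : ∀ i, inner ℝ (inner ℝ (b i) s • G s + g s • b i) (A i s) =
        inner ℝ s (b i) * inner ℝ (b i) s * inner ℝ (G s) d
          - inner ℝ (G s) (b i) * inner ℝ (b i) s * inner ℝ s d
          + g s * (inner ℝ s (b i) * inner ℝ (b i) d) - g s * inner ℝ s d := by
      intro i
      have hb : inner ℝ (b i) (b i) = 1 := by
        rw [real_inner_self_eq_norm_sq, b.norm_eq_one]; norm_num
      simp only [hAapp, inner_add_left, inner_sub_right, real_inner_smul_left,
        real_inner_smul_right, hb]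
      rw [real_inner_comm s (b i), real_inner_comm s d]
      ring
    simp only [e, Finset.sum_sub_distrib, Finset.sum_add_distrib, ← Finset.sum_mul,
      ← Finset.mul_sum, b.sum_inner_mul_inner, Finset.sum_const, Finset.card_univ,
      Fintype.card_fin, nsmul_eq_mul]
    rw [real_inner_self_eq_norm_sq, hs]
    ring
  rw [integral_congr_ae hpt, integral_sub (integrable_uniformSphere hn (by fun_prop))
    (integrable_uniformSphere hn (by fun_prop)), integral_const_mul] at hsum
  linarith

/-- Integration by parts with `g = ⟪a, ·⟫` and `d = a`: the same integral appears on both sides. -/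
theorem integral_inner_sq_uniformSphere (hn : n ≠ 0) (a : EuclideanSpace ℝ (Fin n)) :
    n * ∫ s, inner ℝ a s ^ 2 ∂(uniformSphere n) = ‖a‖ ^ 2 := by
  have := isProbabilityMeasure_uniformSphere hn
  have h := integral_mul_inner_uniformSphere hn (g := fun s => inner ℝ a s) (G := fun _ => a)
    (fun x => by
      rw [hasGradientAt_iff_hasFDerivAt]
      exact (innerSL ℝ a).hasFDerivAt) continuous_const a
  have e : ∀ s : EuclideanSpace ℝ (Fin n), inner ℝ a s * inner ℝ s a = inner ℝ a s ^ 2 := by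
    intro s
    rw [real_inner_comm a s, sq]
  simp only [e] at h
  rw [integral_sub (integrable_const _) (integrable_uniformSphere hn (by fun_prop)),
    integral_const, real_inner_self_eq_norm_sq] at h
  simp only [probReal_univ, smul_eq_mul] at h
  linarith

/-- The divergence theorem on balls, differentiated in the radius. The weight `r ^ (n - 1)` makes
the radial term `⟪G, s⟫ * ⟪s, d⟫` cancel against the one from integration by parts. -/
theorem hasDerivAt_pow_mul_integral_uniformSphere (hn : 2 ≤ n)
    {f : EuclideanSpace ℝ (Fin n) → ℝ}
    {G : EuclideanSpace ℝ (Fin n) → EuclideanSpace ℝ (Fin n)}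
    (hf : ∀ x, HasGradientAt f (G x) x) (hG : Continuous G) (x d : EuclideanSpace ℝ (Fin n))
    (r : ℝ) :
    HasDerivAt (fun r : ℝ => r ^ (n - 1) * ∫ s, f (x + r • s) * inner ℝ s d ∂(uniformSphere n))
      (r ^ (n - 1) * ∫ s, inner ℝ (G (x + r • s)) d ∂(uniformSphere n)) r := by
  have hn0 : n ≠ 0 := by omega
  have hfc : Continuous f := continuous_iff_continuousAt.2 fun x => (hf x).continuousAt
  have hd := hasDerivAt_integral_uniformSphere hn0
    (F := fun r s => f (x + r • s) * inner ℝ s d)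
    (F' := fun r s => inner ℝ (G (x + r • s)) s * inner ℝ s d)
    (fun r => by fun_prop) (by simp only [Function.uncurry_def]; fun_prop)
    (fun r s => by
      have h1 : HasDerivAt (fun r : ℝ => x + r • s) s r := by
        simpa using ((hasDerivAt_id r).smul_const s).const_add x
      simpa using ((hf (x + r • s)).hasFDerivAt.comp_hasDerivAt r h1).mul_const (inner ℝ s d)) r
  have hibp := integral_mul_inner_uniformSphere hn0 (g := fun s => f (x + r • s))
    (G := fun s => r • G (x + r • s))
    (fun s => by
      have h1 : HasFDerivAt (fun s : EuclideanSpace ℝ (Fin n) => x + r • s)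
          (r • ContinuousLinearMap.id ℝ (EuclideanSpace ℝ (Fin n))) s :=
        ((hasFDerivAt_id s).const_smul r).const_add x
      rw [hasGradientAt_iff_hasFDerivAt]
      refine ((hf (x + r • s)).hasFDerivAt.comp s h1).congr_fderiv ?_
      ext y
      simp) (by fun_prop) d
  simp only [real_inner_smul_left] at hibp
  rw [integral_sub (integrable_uniformSphere hn0 (by fun_prop))
    (integrable_uniformSphere hn0 (by fun_prop)), integral_const_mul] at hibp
  simp only [mul_assoc] at hibp
  rw [integral_const_mul] at hibp
  refine ((hasDerivAt_pow (n - 1) r).mul hd).congr_deriv ?_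
  obtain ⟨m, rfl⟩ : ∃ m, n = m + 2 := ⟨n - 2, by omega⟩
  simp only [show m + 2 - 1 = m + 1 from rfl, show m + 1 - 1 = m from rfl] at *
  push_cast at hibp ⊢
  have : (r ^ m) * _ = r ^ m * _ := congrArg (r ^ m * ·) hibp
  ring_nf at this ⊢
  linarith

end Sphere

/-! ### Consequences of smooth convexity. -/

section Smooth

variable {n : ℕ} {L : ℝ} {f : EuclideanSpace ℝ (Fin n) → ℝ}

theorem IsSmoothConvex.add_inner_le (hf : IsSmoothConvex L f) (hL : 0 < L)
    (x v : EuclideanSpace ℝ (Fin n)) : f x + inner ℝ (gradient f x) v ≤ f (x + v) := by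
  have h := hf.lower_bound (x + v) x
  rw [add_sub_cancel_left] at h
  have : 0 ≤ 1 / (2 * L) * ‖gradient f (x + v) - gradient f x‖ ^ 2 := by positivity
  linarith

theorem IsSmoothConvex.le_add_inner (hf : IsSmoothConvex L f) (hL : 0 < L)
    (x v : EuclideanSpace ℝ (Fin n)) :
    f (x + v) ≤ f x + inner ℝ (gradient f x) v + L / 2 * ‖v‖ ^ 2 := by
  have h := hf.lower_bound x (x + v)
  rw [sub_add_cancel_left, inner_neg_right] at h
  set a := gradient f x
  set b := gradient f (x + v)
  -- Completing the square trades the gradient at `x + v` for the one at `x`.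
  have h1 : 0 ≤ 1 / (2 * L) * ‖(a - b) + L • v‖ ^ 2 := by positivity
  rw [norm_add_sq_real, norm_smul, real_inner_smul_right, inner_sub_left, Real.norm_eq_abs,
    mul_pow, sq_abs] at h1
  have e : 1 / (2 * L) * (‖a - b‖ ^ 2 + 2 * (L * (inner ℝ a v - inner ℝ b v)) + L ^ 2 * ‖v‖ ^ 2)
      = 1 / (2 * L) * ‖a - b‖ ^ 2 + (inner ℝ a v - inner ℝ b v) + L / 2 * ‖v‖ ^ 2 := by
    field_simp
  rw [e] at h1
  linarith

/-- Adding the lower bound to its copy with `x` and `y` exchanged gives cocoercivity; Cauchy–Schwarz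
finishes. -/
theorem IsSmoothConvex.norm_gradient_sub_le (hf : IsSmoothConvex L f) (hL : 0 < L)
    (x y : EuclideanSpace ℝ (Fin n)) :
    ‖gradient f x - gradient f y‖ ≤ L * ‖x - y‖ := by
  have h1 := hf.lower_bound x y
  have h2 := hf.lower_bound y x
  rw [norm_sub_rev, ← neg_sub x y, inner_neg_right] at h2
  have h3 := real_inner_le_norm (gradient f x - gradient f y) (x - y)
  rw [inner_sub_left] at h3
  set a := ‖gradient f x - gradient f y‖
  have h4 : 1 / L * a ^ 2 ≤ a * ‖x - y‖ := by
    have : 1 / L * a ^ 2 = 1 / (2 * L) * a ^ 2 + 1 / (2 * L) * a ^ 2 := by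
      field_simp; norm_num
    linarith
  rw [div_mul_eq_mul_div, one_mul, div_le_iff₀ hL] at h4
  rcases (norm_nonneg _ : 0 ≤ a).eq_or_lt with ha | ha
  · rw [show a = 0 from ha.symm]; positivity
  · nlinarith

theorem IsSmoothConvex.continuous_gradient (hf : IsSmoothConvex L f) (hL : 0 < L) :
    Continuous (gradient f) := by
  refine (LipschitzWith.of_dist_le_mul (K := L.toNNReal) fun x y => ?_).continuous
  rw [dist_eq_norm, dist_eq_norm, Real.coe_toNNReal L hL.le]
  exact hf.norm_gradient_sub_le hL x y

theorem IsSmoothConvex.hasGradientAt (hf : IsSmoothConvex L f) (x : EuclideanSpace ℝ (Fin n)) :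
    HasGradientAt f (gradient f x) x :=
  (hf.differentiable x).hasGradientAt

/-- Perturbed first-order inequality: the gradient at `x + v`, tested against `x - u`,
dominates the regret of `x` up to a quadratic error, and in addition a multiple of `‖∇f x‖²`. -/
theorem IsSmoothConvex.le_inner_gradient_add (hf : IsSmoothConvex L f) (hL : 0 < L) {a : ℝ}
    (ha : 0 ≤ a) (haL : 4 * a * L ≤ 1) (x u v : EuclideanSpace ℝ (Fin n)) :
    f x - f u + a * ‖gradient f x‖ ^ 2 - 4 * a * ‖gradient f u‖ ^ 2
      - (4 * a * L ^ 2 + L / 2) * ‖v‖ ^ 2 ≤ inner ℝ (gradient f (x + v)) (x - u) := by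
  have h1 := hf.lower_bound u (x + v)
  have h2 := hf.le_add_inner hL (x + v) (-v)
  rw [add_neg_cancel_right, norm_neg, inner_neg_right] at h2
  have h3 : inner ℝ (gradient f (x + v)) (u - (x + v)) =
      -inner ℝ (gradient f (x + v)) (x - u) - inner ℝ (gradient f (x + v)) v := by
    rw [← inner_neg_right, ← inner_sub_right]
    congr 1
    abel
  have h4 := hf.norm_gradient_sub_le hL x (x + v)
  rw [sub_add_cancel_left, norm_neg] at h4
  have h5 : ‖gradient f x‖ ≤ ‖gradient f u - gradient f (x + v)‖ + (‖gradient f u‖ + L * ‖v‖) := by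
    have e : gradient f x = -(gradient f u - gradient f (x + v)) +
      (gradient f u + (gradient f x - gradient f (x + v))) := by abel
    calc ‖gradient f x‖ = _ := congrArg norm e
      _ ≤ _ := (norm_add_le _ _).trans
        (add_le_add (norm_neg _).le ((norm_add_le _ _).trans (add_le_add le_rfl h4)))
  set p := ‖gradient f u - gradient f (x + v)‖
  have h6 : ‖gradient f x‖ ^ 2 ≤ 2 * p ^ 2 + 4 * ‖gradient f u‖ ^ 2 + 4 * (L * ‖v‖) ^ 2 := by
    have := pow_le_pow_left₀ (norm_nonneg _) h5 2
    nlinarith [sq_nonneg (p - (‖gradient f u‖ + L * ‖v‖)), sq_nonneg (‖gradient f u‖ - L * ‖v‖)]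
  have h7 : a * ‖gradient f x‖ ^ 2 ≤
      2 * a * p ^ 2 + 4 * a * ‖gradient f u‖ ^ 2 + 4 * a * L ^ 2 * ‖v‖ ^ 2 := by
    nlinarith [mul_le_mul_of_nonneg_left h6 ha]
  have h8 : 2 * a * p ^ 2 ≤ 1 / (2 * L) * p ^ 2 := by
    refine mul_le_mul_of_nonneg_right ?_ (sq_nonneg p)
    rw [le_div_iff₀ (by positivity)]
    linarith
  -- The leftover `2 * a * p ^ 2` is absorbed by the squared gradient difference in `h1`; this is
  -- where `4 * a * L ≤ 1` matters.
  rw [h3] at h1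
  linarith

end Smooth

/-! ### Mean and second moment of the gradient estimator. -/

section Estimator

variable {n : ℕ} {L : ℝ} {f : EuclideanSpace ℝ (Fin n) → ℝ}

/-- The antipodal map `s ↦ -s` merges the two evaluations into one. -/
theorem integral_inner_gradEstimator {μ : ℝ} (hn : n ≠ 0) (hμ : 0 < μ) (hf : Continuous f)
    (x d : EuclideanSpace ℝ (Fin n)) :
    ∫ s, inner ℝ (gradEstimator f μ x s) d ∂(uniformSphere n) =
      n / μ * ∫ s, f (x + μ • s) * inner ℝ s d ∂(uniformSphere n) := by
  have h := integral_comp_isometry_uniformSphere (LinearIsometryEquiv.neg ℝ)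
    (fun s : EuclideanSpace ℝ (Fin n) => f (x + μ • s) * inner ℝ s d)
  simp only [LinearIsometryEquiv.coe_neg, inner_neg_left, smul_neg, ← sub_eq_add_neg,
    mul_neg, integral_neg] at h
  simp only [gradEstimator, real_inner_smul_left, mul_assoc, sub_mul]
  rw [integral_const_mul, integral_sub (integrable_uniformSphere hn (by fun_prop))
    (integrable_uniformSphere hn (by fun_prop)), ← h]
  field_simp
  linarith

theorem IsSmoothConvex.le_integral_inner_gradEstimator (hf : IsSmoothConvex L f) (hn : 2 ≤ n)
    (hL : 0 < L) {a : ℝ} (ha : 0 ≤ a) (haL : 4 * a * L ≤ 1) {μ : ℝ} (hμ : 0 < μ)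
    (x u : EuclideanSpace ℝ (Fin n)) :
    f x - f u + a * ‖gradient f x‖ ^ 2 - 4 * a * ‖gradient f u‖ ^ 2
      - (4 * a * L ^ 2 + L / 2) * μ ^ 2 ≤
      ∫ s, inner ℝ (gradEstimator f μ x s) (x - u) ∂(uniformSphere n) := by
  have hn0 : n ≠ 0 := by omega
  have := isProbabilityMeasure_uniformSphere hn0
  have hG := hf.continuous_gradient hL
  rw [integral_inner_gradEstimator hn0 hμ hf.differentiable.continuous]
  set c := f x - f u + a * ‖gradient f x‖ ^ 2 - 4 * a * ‖gradient f u‖ ^ 2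
      - (4 * a * L ^ 2 + L / 2) * μ ^ 2
  set h : ℝ → ℝ := fun r =>
    r ^ (n - 1) * ∫ s, f (x + r • s) * inner ℝ s (x - u) ∂(uniformSphere n)
  have hderiv : ∀ r, HasDerivAt (fun r => h r - c / n * r ^ n)
      (r ^ (n - 1) * ((∫ s, inner ℝ (gradient f (x + r • s)) (x - u) ∂(uniformSphere n)) - c))
      r := by
    intro r
    refine ((hasDerivAt_pow_mul_integral_uniformSphere hn hf.hasGradientAt hG x (x - u) r).sub
      ((hasDerivAt_pow n r).const_mul (c / n))).congr_deriv ?_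
    field_simp
  -- The pointwise lower bound `c` holds on every sphere of radius `r ≤ μ`, so integrating the
  -- derivative from the center, where both terms vanish, gives `c / n * μ ^ n ≤ h μ`.
  have hmono : MonotoneOn (fun r => h r - c / n * r ^ n) (Set.Icc 0 μ) := by
    refine monotoneOn_of_deriv_nonneg (convex_Icc 0 μ)
      (fun r _ => (hderiv r).continuousAt.continuousWithinAt)
      (fun r _ => (hderiv r).differentiableAt.differentiableWithinAt) fun r hr => ?_
    rw [interior_Icc] at hr
    rw [(hderiv r).deriv]
    refine mul_nonneg (pow_nonneg hr.1.le _) (sub_nonneg.2 ?_)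
    calc c = ∫ _, c ∂(uniformSphere n) := by simp
      _ ≤ _ := integral_mono_ae (integrable_const c)
        (integrable_uniformSphere hn0 (by fun_prop)) ?_
    filter_upwards [ae_norm_eq_one_uniformSphere] with s hs
    refine le_trans ?_ (hf.le_inner_gradient_add hL ha haL x u (r • s))
    rw [norm_smul, hs, mul_one, Real.norm_eq_abs, sq_abs]
    have : r ^ 2 ≤ μ ^ 2 := pow_le_pow_left₀ hr.1.le hr.2.le 2
    exact sub_le_sub_left (mul_le_mul_of_nonneg_left this (by positivity)) _
  have h1 := hmono (Set.left_mem_Icc.2 hμ.le) (Set.right_mem_Icc.2 hμ.le) hμ.le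
  simp only [h, zero_pow hn0, zero_pow (show n - 1 ≠ 0 by omega), zero_mul, mul_zero,
    sub_zero, sub_nonneg] at h1
  have h2 : μ ^ n = μ ^ (n - 1) * μ := by rw [← pow_succ]; congr 1; omega
  have hn' : (0 : ℝ) < n := by exact_mod_cast hn0.bot_lt
  rw [h2, mul_left_comm, mul_le_mul_iff_right₀ (by positivity)] at h1
  calc c = n / μ * (c / n * μ) := by field_simp
    _ ≤ _ := mul_le_mul_of_nonneg_left h1 (by positivity)

theorem IsSmoothConvex.norm_gradEstimator_sq_le (hf : IsSmoothConvex L f) (hL : 0 < L) {μ : ℝ}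
    (hμ : 0 < μ) (x : EuclideanSpace ℝ (Fin n)) {s : EuclideanSpace ℝ (Fin n)} (hs : ‖s‖ = 1) :
    ‖gradEstimator f μ x s‖ ^ 2 ≤
      2 * n ^ 2 * inner ℝ (gradient f x) s ^ 2 + n ^ 2 * L ^ 2 * μ ^ 2 / 8 := by
  have h1 := hf.add_inner_le hL x (μ • s)
  have h2 := hf.le_add_inner hL x (μ • s)
  have h3 := hf.add_inner_le hL x (-(μ • s))
  have h4 := hf.le_add_inner hL x (-(μ • s))
  rw [norm_neg] at h4
  simp only [← sub_eq_add_neg, inner_neg_right, real_inner_smul_right, norm_smul, hs, mul_one,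
    Real.norm_eq_abs, sq_abs] at h1 h2 h3 h4
  rw [gradEstimator, norm_smul, hs, mul_one, Real.norm_eq_abs, sq_abs]
  set q := f (x + μ • s) - f (x - μ • s)
  set p := inner ℝ (gradient f x) s
  -- The two Taylor remainders both lie in `[0, L / 2 * μ ^ 2]`, so their difference is no larger
  -- than one of them can be.
  have h5 : (q - 2 * μ * p) ^ 2 ≤ (L / 2 * μ ^ 2) ^ 2 :=
    sq_le_sq' (by linarith) (by linarith)
  have h6 : q ^ 2 ≤ 8 * μ ^ 2 * p ^ 2 + L ^ 2 * μ ^ 4 / 2 := by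
    nlinarith [sq_nonneg (q - 4 * μ * p)]
  calc ((n : ℝ) / (2 * μ) * q) ^ 2 = n ^ 2 / (4 * μ ^ 2) * q ^ 2 := by ring
    _ ≤ n ^ 2 / (4 * μ ^ 2) * (8 * μ ^ 2 * p ^ 2 + L ^ 2 * μ ^ 4 / 2) := by gcongr
    _ = _ := by field_simp; ring

theorem continuous_gradEstimator (hf : Continuous f) (μ : ℝ) :
    Continuous fun p : EuclideanSpace ℝ (Fin n) × EuclideanSpace ℝ (Fin n) =>
      gradEstimator f μ p.1 p.2 := by
  unfold gradEstimator
  fun_prop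

theorem IsSmoothConvex.integral_norm_gradEstimator_sq_le (hf : IsSmoothConvex L f) (hn : n ≠ 0)
    (hL : 0 < L) {μ : ℝ} (hμ : 0 < μ) (x : EuclideanSpace ℝ (Fin n)) :
    ∫ s, ‖gradEstimator f μ x s‖ ^ 2 ∂(uniformSphere n) ≤
      2 * n * ‖gradient f x‖ ^ 2 + n ^ 2 * L ^ 2 * μ ^ 2 / 8 := by
  have := isProbabilityMeasure_uniformSphere hn
  have hc := (continuous_gradEstimator hf.differentiable.continuous μ).comp
    (Continuous.prodMk_right x)
  calc _ ≤ ∫ s, (2 * n ^ 2 * inner ℝ (gradient f x) s ^ 2 + n ^ 2 * L ^ 2 * μ ^ 2 / 8)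
        ∂(uniformSphere n) := by
        refine integral_mono_ae (integrable_uniformSphere hn (hc.norm.pow 2))
          (integrable_uniformSphere hn (by fun_prop)) ?_
        filter_upwards [ae_norm_eq_one_uniformSphere] with s hs
        exact hf.norm_gradEstimator_sq_le hL hμ x hs
    _ = _ := by
        rw [integral_add (integrable_uniformSphere hn (by fun_prop)) (integrable_const _),
          integral_const_mul, integral_const, probReal_univ, one_smul,
          ← integral_inner_sq_uniformSphere hn]
        ring

/-- Expected one-step inequality of bandit gradient descent at the decision `x`. -/
theorem IsSmoothConvex.integral_step_le (hf : IsSmoothConvex L f) (hn : 2 ≤ n) (hL : 0 < L)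
    {η μ : ℝ} (hη : 0 ≤ η) (hηL : 4 * n * η * L ≤ 1) (hμ : 0 < μ)
    (x u : EuclideanSpace ℝ (Fin n)) :
    ∫ s, (f x - f u - inner ℝ (gradEstimator f μ x s) (x - u)
        + η / 2 * ‖gradEstimator f μ x s‖ ^ 2) ∂(uniformSphere n) ≤
      4 * n * η * (‖gradient f u‖ ^ 2 + L ^ 2 * μ ^ 2) + η * n ^ 2 * L ^ 2 * μ ^ 2 / 16
        + L * μ ^ 2 / 2 := by
  have hn0 : n ≠ 0 := by omega
  have := isProbabilityMeasure_uniformSphere hn0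
  have hc := (continuous_gradEstimator hf.differentiable.continuous μ).comp
    (Continuous.prodMk_right x)
  have hc1 : Continuous fun s => inner ℝ (gradEstimator f μ x s) (x - u) :=
    hc.inner continuous_const
  have hc2 : Continuous fun s => η / 2 * ‖gradEstimator f μ x s‖ ^ 2 :=
    continuous_const.mul (hc.norm.pow 2)
  have hc3 : Continuous fun s => f x - f u - inner ℝ (gradEstimator f μ x s) (x - u) :=
    continuous_const.sub hc1
  rw [integral_add (integrable_uniformSphere hn0 hc3)
      (integrable_uniformSphere hn0 hc2),
    integral_sub (integrable_const _) (integrable_uniformSphere hn0 hc1), integral_const,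
    probReal_univ, one_smul, integral_const_mul]
  -- This `a` matches `η / 2` times the coefficient `2 * n` in the second moment, so `‖∇f x‖ ^ 2`
  -- drops out.
  have h1 := hf.le_integral_inner_gradEstimator hn hL (a := n * η) (by positivity)
    (by linarith) hμ x u
  have h2 := mul_le_mul_of_nonneg_left (hf.integral_norm_gradEstimator_sq_le hn0 hL hμ x)
    (by positivity : 0 ≤ η / 2)
  linarith

end Estimator

/-! ### The projection is nonexpansive. -/

section Projection

variable {n : ℕ} {K : Set (EuclideanSpace ℝ (Fin n))}

theorem inner_sub_proj_le_zero (hcl : IsClosed K) (hcv : Convex ℝ K)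
    (y : EuclideanSpace ℝ (Fin n)) {w : EuclideanSpace ℝ (Fin n)} (hw : w ∈ K) :
    inner ℝ (y - proj K y) (w - proj K y) ≤ 0 := by
  obtain ⟨hmem, hmin⟩ := proj_spec ⟨w, hw⟩ hcl y
  have : Nonempty K := ⟨⟨w, hw⟩⟩
  refine (norm_eq_iInf_iff_real_inner_le_zero hcv hmem).1 (le_antisymm ?_ ?_) w hw
  · refine le_ciInf fun z => ?_
    simpa only [dist_eq_norm] using hmin z z.2
  · exact ciInf_le ⟨0, by rintro _ ⟨z, rfl⟩; exact norm_nonneg _⟩ (⟨_, hmem⟩ : K)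

theorem norm_proj_sub_le (hcl : IsClosed K) (hcv : Convex ℝ K)
    (y : EuclideanSpace ℝ (Fin n)) {w : EuclideanSpace ℝ (Fin n)} (hw : w ∈ K) :
    ‖proj K y - w‖ ≤ ‖y - w‖ := by
  have h := inner_sub_proj_le_zero hcl hcv y hw
  rw [← neg_sub (proj K y) w, inner_neg_right] at h
  have e : y - w = (y - proj K y) + (proj K y - w) := by abel
  refine le_of_sq_le_sq ?_ (norm_nonneg _)
  rw [e, norm_add_sq_real]
  nlinarith [sq_nonneg ‖y - proj K y‖]

theorem continuous_proj (hne : K.Nonempty) (hcl : IsClosed K) (hcv : Convex ℝ K) :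
    Continuous (proj K) := by
  refine (LipschitzWith.of_dist_le_mul (K := 1) fun x y => ?_).continuous
  have h1 := inner_sub_proj_le_zero hcl hcv x (proj_spec hne hcl y).1
  have h2 := inner_sub_proj_le_zero hcl hcv y (proj_spec hne hcl x).1
  rw [NNReal.coe_one, one_mul, dist_eq_norm, dist_eq_norm]
  set p := proj K x
  set q := proj K y
  have e : ‖p - q‖ ^ 2 = inner ℝ (x - y) (p - q) + inner ℝ (x - p) (q - p)
      + inner ℝ (y - q) (p - q) := by
    rw [← real_inner_self_eq_norm_sq, ← neg_sub p q, inner_neg_right, ← inner_neg_left,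
      ← inner_add_left, ← inner_add_left]
    congr 1
    abel
  have h3 := real_inner_le_norm (x - y) (p - q)
  rcases (norm_nonneg (p - q)).eq_or_lt with h0 | h0
  · rw [← h0]; exact norm_nonneg _
  · refine le_of_mul_le_mul_right ?_ h0
    linarith [sq ‖p - q‖]

end Projection

/-! ### Pathwise analysis of the iteration. -/

section Trajectory

variable {n : ℕ} {K : Set (EuclideanSpace ℝ (Fin n))} {ℓ : ℕ → EuclideanSpace ℝ (Fin n) → ℝ}
  {η μ : ℝ} {x₁ : EuclideanSpace ℝ (Fin n)}

theorem bgd_mem (hcl : IsClosed K) (hx₁ : x₁ ∈ K) (s : ℕ → EuclideanSpace ℝ (Fin n)) (t : ℕ) :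
    bgd K ℓ η μ x₁ s t ∈ K := by
  cases t with
  | zero => exact hx₁
  | succ t => exact (proj_spec ⟨x₁, hx₁⟩ hcl _).1

theorem bgd_congr {s s' : ℕ → EuclideanSpace ℝ (Fin n)} {t : ℕ} (h : ∀ i < t, s i = s' i) :
    bgd K ℓ η μ x₁ s t = bgd K ℓ η μ x₁ s' t := by
  induction t with
  | zero => rfl
  | succ t ih => rw [bgd, bgd, ih fun i hi => h i (by omega), h t (by omega)]

theorem continuous_bgd (hne : K.Nonempty) (hcl : IsClosed K) (hcv : Convex ℝ K) {t : ℕ}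
    (hℓ : ∀ i < t, Continuous (ℓ i)) : Continuous fun s => bgd K ℓ η μ x₁ s t := by
  induction t with
  | zero => exact continuous_const
  | succ t ih =>
    have ih := ih fun i hi => hℓ i (by omega)
    have hg : Continuous fun s : ℕ → EuclideanSpace ℝ (Fin n) =>
        gradEstimator (ℓ t) μ (bgd K ℓ η μ x₁ s t) (s t) :=
      (continuous_gradEstimator (hℓ t (by omega)) μ).comp (ih.prodMk (continuous_apply t))
    exact (continuous_proj hne hcl hcv).comp (ih.sub (hg.const_smul η))

theorem loss_sub_le_step (hcl : IsClosed K) (hcv : Convex ℝ K) (hη : 0 < η)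
    {u : EuclideanSpace ℝ (Fin n)} (hu : u ∈ K) (s : ℕ → EuclideanSpace ℝ (Fin n)) (t : ℕ) :
    ‖bgd K ℓ η μ x₁ s (t + 1) - u‖ ^ 2 / (2 * η) ≤ ‖bgd K ℓ η μ x₁ s t - u‖ ^ 2 / (2 * η)
      - inner ℝ (gradEstimator (ℓ t) μ (bgd K ℓ η μ x₁ s t) (s t)) (bgd K ℓ η μ x₁ s t - u)
      + η / 2 * ‖gradEstimator (ℓ t) μ (bgd K ℓ η μ x₁ s t) (s t)‖ ^ 2 := by
  rw [bgd]
  set x := bgd K ℓ η μ x₁ s t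
  set g := gradEstimator (ℓ t) μ x (s t)
  have h := pow_le_pow_left₀ (norm_nonneg _) (norm_proj_sub_le hcl hcv (x - η • g) hu) 2
  have e : ‖x - η • g - u‖ ^ 2 = ‖x - u‖ ^ 2 - 2 * η * inner ℝ g (x - u) + η ^ 2 * ‖g‖ ^ 2 := by
    rw [sub_right_comm, norm_sub_sq_real, real_inner_smul_right, norm_smul, Real.norm_eq_abs,
      mul_pow, sq_abs, real_inner_comm]
    ring
  rw [e] at h
  rw [div_le_iff₀ (by positivity)]
  refine h.trans_eq ?_
  field_simp

end Trajectory

/-! ### Averaging over an independent direction. -/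

section Expectation

variable {n : ℕ} {Ω : Type*} [MeasurableSpace Ω] {P : Measure Ω} [IsProbabilityMeasure P]
  {K : Set (EuclideanSpace ℝ (Fin n))} {X S : Ω → EuclideanSpace ℝ (Fin n)}
  {Φ : EuclideanSpace ℝ (Fin n) × EuclideanSpace ℝ (Fin n) → ℝ}

theorem integrable_comp_prodMk (hK : IsCompact K) (hX : AEMeasurable X P) (hXK : ∀ ω, X ω ∈ K)
    (hS : HasLaw S (uniformSphere n) P) (hΦ : Continuous Φ) :
    Integrable (fun ω => Φ (X ω, S ω)) P := by
  obtain ⟨C, hC⟩ := (hK.prod (isCompact_sphere (0 : EuclideanSpace ℝ (Fin n)) 1)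
    ).exists_bound_of_continuousOn hΦ.continuousOn
  have hS1 : ∀ᵐ ω ∂P, ‖S ω‖ = 1 :=
    ae_of_ae_map hS.aemeasurable (by rw [hS.map_eq]; exact ae_norm_eq_one_uniformSphere)
  refine Integrable.of_bound
    (hΦ.measurable.comp_aemeasurable (hX.prodMk hS.aemeasurable)).aestronglyMeasurable C ?_
  filter_upwards [hS1] with ω hω
  exact hC _ ⟨hXK ω, by simpa using hω⟩

/-- Independence turns the joint law into a product, so Fubini allows averaging over the direction
with the decision frozen. -/
theorem integral_comp_prodMk_le (hn : n ≠ 0) (hK : IsCompact K) (hX : AEMeasurable X P)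
    (hXK : ∀ ω, X ω ∈ K) (hS : HasLaw S (uniformSphere n) P) (hXS : IndepFun X S P)
    (hΦ : Continuous Φ) {c : ℝ} (hc : ∀ x, ∫ s, Φ (x, s) ∂(uniformSphere n) ≤ c) :
    ∫ ω, Φ (X ω, S ω) ∂P ≤ c := by
  have := isProbabilityMeasure_uniformSphere hn
  have := Measure.isProbabilityMeasure_map hX
  have hm := (indepFun_iff_map_prod_eq_prod_map_map hX hS.aemeasurable).1 hXS
  rw [hS.map_eq] at hm
  have hint : Integrable Φ ((P.map X).prod (uniformSphere n)) := by
    rw [← hm, integrable_map_measure hΦ.aestronglyMeasurable (hX.prodMk hS.aemeasurable)]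
    exact integrable_comp_prodMk hK hX hXK hS hΦ
  calc ∫ ω, Φ (X ω, S ω) ∂P = ∫ p, Φ p ∂((P.map X).prod (uniformSphere n)) := by
        rw [← hm, integral_map (hX.prodMk hS.aemeasurable) hΦ.aestronglyMeasurable]
    _ = ∫ x, ∫ s, Φ (x, s) ∂(uniformSphere n) ∂(P.map X) := integral_prod _ hint
    _ ≤ ∫ _, c ∂(P.map X) := integral_mono hint.integral_prod_left (integrable_const c) hc
    _ = c := by simp

end Expectation

/-! ### Expected regret for a general step. -/

section Regret

variable {n : ℕ} {L D : ℝ} {T : ℕ} {ℓ : ℕ → EuclideanSpace ℝ (Fin n) → ℝ}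
  {K : Set (EuclideanSpace ℝ (Fin n))} {η μ : ℝ} {x₁ : EuclideanSpace ℝ (Fin n)}
  {Ω : Type*} [MeasurableSpace Ω] {P : Measure Ω}
  {s : ℕ → Ω → EuclideanSpace ℝ (Fin n)}

theorem aemeasurable_bgd_and_indepFun (hℓ : ∀ t < T, Continuous (ℓ t)) (hcl : IsClosed K)
    (hcv : Convex ℝ K) (hne : K.Nonempty) (hs : ∀ t < T, AEMeasurable (s t) P)
    (hs_indep : iIndepFun (fun t : Fin T => s t) P) {t : ℕ} (ht : t < T) :
    AEMeasurable (fun ω => bgd K ℓ η μ x₁ (fun i => s i ω) t) P ∧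
      IndepFun (fun ω => bgd K ℓ η μ x₁ (fun i => s i ω) t) (s t) P := by
  let A : Finset (Fin T) := Finset.univ.filter fun i => i.1 < t
  -- Padding by zero is harmless: the decision of round `t` reads only directions with index below
  -- `t`.
  let ext (z : A → EuclideanSpace ℝ (Fin n)) (i : ℕ) : EuclideanSpace ℝ (Fin n) :=
    if h : i < t then z ⟨⟨i, h.trans ht⟩, by simp [A, h]⟩ else 0
  have hext : Continuous ext := by
    refine continuous_pi fun i => ?_
    by_cases h : i < t
    · simpa only [ext, h, dite_true] using continuous_apply _
    · simpa only [ext, h, dite_false] using continuous_const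
  have hφ : Measurable fun z => bgd K ℓ η μ x₁ (ext z) t :=
    ((continuous_bgd hne hcl hcv fun i hi => hℓ i (hi.trans ht)).comp hext).measurable
  have hbgd : (fun ω => bgd K ℓ η μ x₁ (fun i => s i ω) t) =
      (fun z => bgd K ℓ η μ x₁ (ext z) t) ∘ fun ω (i : A) => s i ω := by
    funext ω
    refine bgd_congr fun i hi => ?_
    simp only [ext, hi, dite_true]
  have hmeas : ∀ i : Fin T, AEMeasurable (s i) P := fun i => hs i i.2
  rw [hbgd]
  refine ⟨hφ.comp_aemeasurable (aemeasurable_pi_lambda _ fun i => hmeas i), ?_⟩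
  have hind := hs_indep.indepFun_finset₀ A {⟨t, ht⟩} (by simp [A]) hmeas
  exact hind.comp hφ (measurable_pi_apply (⟨⟨t, ht⟩, by simp⟩ : ({⟨t, ht⟩} : Finset (Fin T))))

/-- The regret bound of bandit gradient descent for an arbitrary step `η ≤ 1 / (4 n L)`. -/
theorem integral_regret_le [IsProbabilityMeasure P] (hn : 2 ≤ n) (hL : 0 < L) (hℓ : ∀ t < T, IsSmoothConvex L (ℓ t))
    (hcl : IsClosed K) (hcv : Convex ℝ K) (hbd : Bornology.IsBounded K)
    (hdiam : Metric.diam K ≤ D) (hx₁ : x₁ ∈ K)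
    (hs_law : ∀ t < T, HasLaw (s t) (uniformSphere n) P)
    (hs_indep : iIndepFun (fun t : Fin T => s t) P)
    (hη : 0 < η) (hηL : 4 * n * η * L ≤ 1) (hμ : 0 < μ)
    {u : EuclideanSpace ℝ (Fin n)} (hu : u ∈ K) :
    Integrable (fun ω => regret ℓ T (bgd K ℓ η μ x₁ fun t => s t ω) u) P ∧
    ∫ ω, regret ℓ T (bgd K ℓ η μ x₁ fun t => s t ω) u ∂P ≤
      D ^ 2 / (2 * η) + 4 * n * η * (cumGrad ℓ T u + T * L ^ 2 * μ ^ 2)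
        + η * T * n ^ 2 * L ^ 2 * μ ^ 2 / 16 + T * L * μ ^ 2 / 2 := by
  have hK : IsCompact K := Metric.isCompact_of_isClosed_isBounded hcl hbd
  have hcont : ∀ t < T, Continuous (ℓ t) := fun t ht => (hℓ t ht).differentiable.continuous
  let X (t : ℕ) (ω : Ω) := bgd K ℓ η μ x₁ (fun i => s i ω) t
  have hXK : ∀ t ω, X t ω ∈ K := fun t ω => bgd_mem hcl hx₁ _ t
  have hX := fun t (ht : t < T) => aemeasurable_bgd_and_indepFun (η := η) (μ := μ) (x₁ := x₁)
    hcont hcl hcv ⟨u, hu⟩ (fun t ht => (hs_law t ht).aemeasurable) hs_indep ht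
  let Φ (t : ℕ) (p : EuclideanSpace ℝ (Fin n) × EuclideanSpace ℝ (Fin n)) : ℝ :=
    ℓ t p.1 - ℓ t u - inner ℝ (gradEstimator (ℓ t) μ p.1 p.2) (p.1 - u)
      + η / 2 * ‖gradEstimator (ℓ t) μ p.1 p.2‖ ^ 2
  have hΦ : ∀ t < T, Continuous (Φ t) := by
    intro t ht
    have h1 := continuous_gradEstimator (hcont t ht) μ
    have h2 : Continuous fun p : EuclideanSpace ℝ (Fin n) × EuclideanSpace ℝ (Fin n) => ℓ t p.1 :=
      (hcont t ht).comp continuous_fst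
    exact ((h2.sub continuous_const).sub (h1.inner (continuous_fst.sub continuous_const))).add
      (continuous_const.mul (h1.norm.pow 2))
  have hΦint : ∀ t < T, Integrable (fun ω => Φ t (X t ω, s t ω)) P := fun t ht =>
    integrable_comp_prodMk hK (hX t ht).1 (hXK t) (hs_law t ht) (hΦ t ht)
  have hint : Integrable (fun ω => regret ℓ T (bgd K ℓ η μ x₁ fun t => s t ω) u) P := by
    unfold regret
    refine (integrable_finsetSum _ fun t ht => ?_).sub (integrable_const _)
    have ht := Finset.mem_range.1 ht
    exact integrable_comp_prodMk (Φ := fun p => ℓ t p.1) hK (hX t ht).1 (hXK t) (hs_law t ht)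
      ((hcont t ht).comp continuous_fst)
  refine ⟨hint, ?_⟩
  have hpt : ∀ ω, regret ℓ T (bgd K ℓ η μ x₁ fun t => s t ω) u ≤
      D ^ 2 / (2 * η) + ∑ t ∈ Finset.range T, Φ t (X t ω, s t ω) := by
    intro ω
    have htel : ∑ t ∈ Finset.range T, (ℓ t (X t ω) - ℓ t u) ≤
        ∑ t ∈ Finset.range T, ((‖X t ω - u‖ ^ 2 / (2 * η) - ‖X (t + 1) ω - u‖ ^ 2 / (2 * η))
          + Φ t (X t ω, s t ω)) := by
      refine Finset.sum_le_sum fun t _ => ?_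
      have h := loss_sub_le_step (ℓ := ℓ) (μ := μ) (x₁ := x₁) hcl hcv hη hu (fun i => s i ω) t
      simp only [X, Φ]
      linarith
    rw [Finset.sum_add_distrib, Finset.sum_range_sub', Finset.sum_sub_distrib] at htel
    have h0 : ‖X 0 ω - u‖ ≤ D := by
      rw [← dist_eq_norm]
      exact (Metric.dist_le_diam_of_mem hbd hx₁ hu).trans hdiam
    have h1 : ‖X 0 ω - u‖ ^ 2 / (2 * η) ≤ D ^ 2 / (2 * η) := by gcongr
    have h2 : 0 ≤ ‖X T ω - u‖ ^ 2 / (2 * η) := by positivity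
    unfold regret
    linarith
  have hsumint : Integrable (fun ω => ∑ t ∈ Finset.range T, Φ t (X t ω, s t ω)) P :=
    integrable_finsetSum _ fun t ht => hΦint t (Finset.mem_range.1 ht)
  calc _ ≤ ∫ ω, (D ^ 2 / (2 * η) + ∑ t ∈ Finset.range T, Φ t (X t ω, s t ω)) ∂P :=
        integral_mono hint ((integrable_const _).add hsumint) hpt
    _ = D ^ 2 / (2 * η) + ∑ t ∈ Finset.range T, ∫ ω, Φ t (X t ω, s t ω) ∂P := by
        rw [integral_add (integrable_const _) hsumint, integral_const, probReal_univ, one_smul,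
          integral_finsetSum _ fun t ht => hΦint t (Finset.mem_range.1 ht)]
    _ ≤ D ^ 2 / (2 * η) + ∑ t ∈ Finset.range T, (4 * n * η * (‖gradient (ℓ t) u‖ ^ 2
          + L ^ 2 * μ ^ 2) + η * n ^ 2 * L ^ 2 * μ ^ 2 / 16 + L * μ ^ 2 / 2) := by
        gcongr with t ht
        have ht := Finset.mem_range.1 ht
        exact integral_comp_prodMk_le (by omega) hK (hX t ht).1 (hXK t) (hs_law t ht) (hX t ht).2
          (hΦ t ht) fun x => (hℓ t ht).integral_step_le hn hL hη.le hηL hμ x u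
    _ = _ := by
        simp only [Finset.sum_add_distrib, mul_add, ← Finset.mul_sum, Finset.sum_const,
          Finset.card_range, nsmul_eq_mul, cumGrad]
        ring

theorem cumGrad_nonneg (u : EuclideanSpace ℝ (Fin n)) : 0 ≤ cumGrad ℓ T u :=
  Finset.sum_nonneg fun _ _ => sq_nonneg _

end Regret

/-- If the first term is the minimum, the sum is `3 * D * √(n * G)`. Otherwise `√(n * G) ≤ 2 * n * L
* D`, and the sum is at most `6 * n * L * D ^ 2`. -/
theorem tunedStep_bounds {n : ℕ} (hn : n ≠ 0) {L D G : ℝ} (hL : 0 < L) (hD : 0 < D)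
    (hG : 0 ≤ G) :
    0 < tunedStep n L D G ∧ tunedStep n L D G ≤ 1 / (8 * n * L) ∧
      D ^ 2 / (2 * tunedStep n L D G) + 4 * n * tunedStep n L D G * G ≤
        max (8 * n * L * D ^ 2) (4 * D * √(n * G)) := by
  have hn' : (0 : ℝ) < n := by exact_mod_cast hn.bot_lt
  have h8 : D ^ 2 / (2 * (1 / (8 * n * L))) = 4 * n * L * D ^ 2 := by field_simp; norm_num
  unfold tunedStep
  split_ifs with h
  · refine ⟨by positivity, le_rfl, le_max_of_le_left ?_⟩
    rw [h8, h]
    have : 0 ≤ n * L * D ^ 2 := by positivity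
    linarith
  · have hG : 0 < G := hG.lt_of_ne' h
    have hr : 0 < √(n * G) := Real.sqrt_pos.2 (by positivity)
    have hsq : √(n * G) ^ 2 = n * G := Real.sq_sqrt (by positivity)
    refine ⟨lt_min (by positivity) (by positivity), min_le_right _ _, ?_⟩
    rcases le_total (D / (4 * √(n * G))) (1 / (8 * n * L)) with hle | hle
    · rw [min_eq_left hle]
      refine le_max_of_le_right ?_
      have h1 : D ^ 2 / (2 * (D / (4 * √(n * G)))) = 2 * D * √(n * G) := by field_simp; norm_num
      have h2 : 4 * n * (D / (4 * √(n * G))) * G = D * √(n * G) := by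
        field_simp
        linarith
      have : 0 ≤ D * √(n * G) := by positivity
      rw [h1, h2]
      linarith
    · rw [min_eq_right hle, h8]
      refine le_max_of_le_left ?_
      rw [div_le_div_iff₀ (by positivity) (by positivity)] at hle
      have h1 : √(n * G) ≤ 2 * n * L * D := by linarith
      have h2 : n * G ≤ n * (4 * n * L ^ 2 * D ^ 2) := by
        have := pow_le_pow_left₀ hr.le h1 2
        rw [hsq] at this
        linarith
      have h3 := le_of_mul_le_mul_left h2 hn'
      have h4 : 4 * n * (1 / (8 * n * L)) * G = G / (2 * L) := by field_simp; norm_num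
      have h5 : G / (2 * L) ≤ 2 * n * L * D ^ 2 := by
        rw [div_le_iff₀ (by positivity)]
        linarith
      have : 0 ≤ n * L * D ^ 2 := by positivity
      rw [h4]
      linarith

end BanditGD

theorem mainTheorem8 {n : ℕ} (hn : 8 ≤ n) {L D : ℝ} (hL : 0 < L) {T : ℕ} (hT : 1 ≤ T)
    (ℓ : ℕ → EuclideanSpace ℝ (Fin n) → ℝ)
    (hℓ : ∀ t < T, BanditGD.IsSmoothConvex L (ℓ t))
    (K : Set (EuclideanSpace ℝ (Fin n))) (hKclosed : IsClosed K) (hKconvex : Convex ℝ K)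
    (hKbounded : Bornology.IsBounded K) (hKdiam : Metric.diam K ≤ D)
    (x₁ : EuclideanSpace ℝ (Fin n)) (hx₁ : x₁ ∈ K)
    {Ω : Type*} [MeasurableSpace Ω] (P : Measure Ω) [IsProbabilityMeasure P]
    (s : ℕ → Ω → EuclideanSpace ℝ (Fin n))
    (hs_law : ∀ t < T, HasLaw (s t) (BanditGD.uniformSphere n) P)
    (hs_indep : iIndepFun (fun t : Fin T => s t) P) :
    (∀ η μ : ℝ, 0 < η → η < 1 / (4 * n * L) → 0 < μ → ∀ x ∈ K,
      Integrable (fun ω =>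
        BanditGD.regret ℓ T (BanditGD.bgd K ℓ η μ x₁ (fun t => s t ω)) x) P ∧
      ∫ ω, BanditGD.regret ℓ T (BanditGD.bgd K ℓ η μ x₁ (fun t => s t ω)) x ∂P ≤
        D ^ 2 / (2 * η)
          + 4 * n * η / (1 - 4 * n * η * L) * BanditGD.cumGrad ℓ T x
          + 4 * n * η / (1 - 4 * n * η * L) * (T * L ^ 2 * μ ^ 2)
          + η * T / 2 * n ^ 2 * L ^ 2 * μ ^ 2
          + T * L * μ ^ 2 / 2) ∧
    (∀ xstar ∈ K, IsMinOn (fun y => ∑ t ∈ Finset.range T, ℓ t y) K xstar →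
      ∀ η μ : ℝ, η = BanditGD.tunedStep n L D (BanditGD.cumGrad ℓ T xstar) →
        0 < μ → μ ≤ D / √(2 * n * T) →
      Integrable (fun ω =>
        BanditGD.regret ℓ T (BanditGD.bgd K ℓ η μ x₁ (fun t => s t ω)) xstar) P ∧
      ∫ ω, BanditGD.regret ℓ T (BanditGD.bgd K ℓ η μ x₁ (fun t => s t ω)) xstar ∂P ≤
        max (8 * n * L * D ^ 2) (4 * D * √(n * BanditGD.cumGrad ℓ T xstar))
          + L * D ^ 2 / 2) := by
  obtain hn2 : 2 ≤ n := by omega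
  have hn0 : (0 : ℝ) < n := by exact_mod_cast (by omega : 0 < n)
  have hn8 : (8 : ℝ) ≤ n := by exact_mod_cast hn
  refine ⟨fun η μ hη hηL hμ x hx => ?_, fun u hu _ η μ hη hμ hμD => ?_⟩
  · rw [lt_div_iff₀ (by positivity)] at hηL
    obtain ⟨hint, hle⟩ := BanditGD.integral_regret_le hn2 hL hℓ hKclosed hKconvex hKbounded
      hKdiam hx₁ hs_law hs_indep hη (by linarith) hμ hx
    refine ⟨hint, hle.trans ?_⟩
    have hG := BanditGD.cumGrad_nonneg (ℓ := ℓ) (T := T) x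
    -- The general bound is already sharper: it lacks the denominator, which lies in `(0, 1)`.
    have h1 : 4 * n * η ≤ 4 * n * η / (1 - 4 * n * η * L) := by
      have : 0 < n * η * L := by positivity
      exact le_div_self (by positivity) (by linarith) (by linarith)
    have h2 := mul_le_mul_of_nonneg_right h1
      (by positivity : 0 ≤ BanditGD.cumGrad ℓ T x + T * L ^ 2 * μ ^ 2)
    have h3 : 0 ≤ η * T * n ^ 2 * L ^ 2 * μ ^ 2 := by positivity
    linarith
  · have hT0 : (0 : ℝ) < T := by exact_mod_cast (by omega : 0 < T)
    have hr : 0 < √(2 * n * T) := Real.sqrt_pos.2 (by positivity)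
    rw [le_div_iff₀ hr] at hμD
    have hD : 0 < D := (mul_pos hμ hr).trans_le hμD
    have hμT : 2 * n * (T * μ ^ 2) ≤ D ^ 2 := by
      have := pow_le_pow_left₀ (by positivity) hμD 2
      rw [mul_pow, Real.sq_sqrt (by positivity)] at this
      linarith
    obtain ⟨hη0, hη8, hmax⟩ := BanditGD.tunedStep_bounds (n := n) (by omega) hL hD
      (BanditGD.cumGrad_nonneg (ℓ := ℓ) (T := T) u)
    rw [← hη] at hη0 hη8 hmax
    rw [le_div_iff₀ (by positivity)] at hη8
    have hηL : 8 * (n * η * L) ≤ 1 := by linarith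
    obtain ⟨hint, hle⟩ := BanditGD.integral_regret_le hn2 hL hℓ hKclosed hKconvex hKbounded
      hKdiam hx₁ hs_law hs_indep hη0 (by linarith) hμ hu
    refine ⟨hint, hle.trans ?_⟩
    -- With `M = L * T * μ ^ 2`, the smoothing errors total at most `M * (1 + n / 128)`; `n ≥ 8` and
    -- `2 * n * M ≤ L * D ^ 2` bring this below `L * D ^ 2 / 2`.
    have hm : 0 ≤ L * (T * μ ^ 2) := by positivity
    have h1 : 4 * n * η * (T * L ^ 2 * μ ^ 2) ≤ L * (T * μ ^ 2) / 2 := by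
      have := mul_le_mul_of_nonneg_right hηL hm
      linarith
    have h2 : η * T * n ^ 2 * L ^ 2 * μ ^ 2 / 16 ≤ n * (L * (T * μ ^ 2)) / 128 := by
      have := mul_le_mul_of_nonneg_right hηL (mul_nonneg hn0.le hm)
      linarith
    have h3 : 2 * n * (L * (T * μ ^ 2)) ≤ L * D ^ 2 := by
      have := mul_le_mul_of_nonneg_left hμT hL.le
      linarith
    have h4 : 8 * (L * (T * μ ^ 2)) ≤ n * (L * (T * μ ^ 2)) :=
      mul_le_mul_of_nonneg_right hn8 hm
    linarith
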